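/- **Linear complexity of partial roofs.** There is an absolute constant $c$ such that every partial roof $R$ for a chain $C$ of $k$ consecutive edges ($1\le k\le n$) of a simple $n$-gon $P$ has combinatorial complexity (total number of vertices, edges and faces) at most $ck$. Here $P$ is counter-clockwise, no two motorcycles of $P$ crash at the same place and time, and any two slabs of $P$ meet within a line. The notions are as follows. *Slabs.* The *motorcycle* of a reflex vertex $u$ (interior angle $\theta>\pi$) starts at $u$ at time $0$ and moves along the inner bisector with speed $1/\sin(\theta/2)$, until it crashes, at a time $t_u>0$, into an edge of $P$ or into the track that another motorcycle has already left. With $c_u$ the crash site, the *lifted track* of $u$ is the segment in $\mathbb R^3$ from $(u,0)$ to $(c_u,t_u)$. For an edge $e$ of $P$ (the *base edge*), the *slope vector* $S_e$ is the unit vector orthogonal to $e$, above the inner side of $e$, at angle $\pi/4$ with the $xy$-plane. $\mathrm{slab}(e)$ is the set of all $p+tS_e$ with $t\ge 0$ and $p$ on $e$ or on the lifted track of a reflex endpoint of $e$ (these tracks are the *motorcycle edges* of the slab). The *straight skeleton roof* of $P$ is the part of the lower envelope of all slabs above the interior of $P$; its face for $e$ is the part on $\mathrm{slab}(e)$, and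 its edges between two faces are the maximal segments of their intersection. $\mathbb R^3$ is extended by one point at infinity for each unit vector. *Partial roofs.* A partial roof $R$ for $C$ is a surface obtained by gluing $k$ simple, possibly unbounded, polygons along edges (intrinsically: self-intersections in $\mathbb R^3$ are allowed), one on $\mathrm{slab}(e)$ for each edge $e$ of $C$, where glued edges are equal in $\mathbb R^3$. It is topologically a disk, and no vertex of degree two has both its edges on one line (no needless subdivision). Counter-clockwise from its base edge $e$, the boundary of a face consists of edges on the right motorcycle edge, the right interior chain, at most two slope edges, the left interior chain, and edges on the left motorcycle edge, each part possibly empty. Interior chains have finite vertices, are monotone with respect to $e$, and overlap at most vertically at their upper ends (the terminal points); slope edges are parallel to $S_e$, and unbounded ones go to infinity in direction $S_e$. Moreover: 1. (Face monotonicity) every line in the slab orthogonal to the base edge meets the face in a connected set; 2. (Face containment) each face contains the face of the straight skeleton roof on the same slab; 3. (Edge containment) each edge of the straight skeleton roof between the slabs of two edges of $C$ is contained in an edge of $R$ between the two corresponding faces; 4. (Boundary property) the boundary of $R$ consists of the *defining chain*, formed by the base edges in their order along $P$, and the *fringe*, a chain formed by the remaining boundary edges; edges of interior chains are internal in $R$,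 slope edges are on the fringe, and an edge of a face on a motorcycle edge of its slab is on the fringe if and only if the defining chain ends at the endpoint of the base edge from which that motorcycle edge emanates. -/

import Mathlib

namespace StraightSkeleton

noncomputable section

/-! ## Simple polygons -/

abbrev Plane := EuclideanSpace ℝ (Fin 2)

abbrev Space := EuclideanSpace ℝ (Fin 3)

/-- The point of space above `q` at height `z`. -/
def lift (q : Plane) (z : ℝ) : Space := !₂[q 0, q 1, z]

/-- The orthogonal projection to the `xy`-plane. -/
def proj (x : Space) : Plane := !₂[x 0, x 1]

def cross (u v : Plane) : ℝ := u 0 * v 1 - u 1 * v 0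

/-- A simple polygon with `n` vertices, listed in counter-clockwise order (positive signed area);
edge `i` joins vertex `i` to vertex `i + 1`. -/
structure SimplePolygon (n : ℕ) [NeZero n] where
  three_le : 3 ≤ n
  vertex : ZMod n → Plane
  vertex_ne : ∀ i, vertex i ≠ vertex (i + 1)
  adjacent : ∀ i, segment ℝ (vertex i) (vertex (i + 1)) ∩
    segment ℝ (vertex (i + 1)) (vertex (i + 1 + 1)) = {vertex (i + 1)}
  nonadjacent : ∀ i j, j ≠ i → j ≠ i + 1 → i ≠ j + 1 →
    Disjoint (segment ℝ (vertex i) (vertex (i + 1))) (segment ℝ (vertex j) (vertex (j + 1)))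
  counterclockwise : 0 < ∑ i, cross (vertex i) (vertex (i + 1))

namespace SimplePolygon

variable {n : ℕ} [NeZero n] (P : SimplePolygon n)

def boundary : Set Plane := ⋃ i, segment ℝ (P.vertex i) (P.vertex (i + 1))

/-- The points of the complement of the boundary that lie in a bounded component of it. -/
def interior : Set Plane :=
  {q | q ∉ P.boundary ∧ Bornology.IsBounded (connectedComponentIn P.boundaryᶜ q)}

/-- The unit vector along edge `i`, in counter-clockwise direction. -/
def dir (i : ZMod n) : Plane :=
  ‖P.vertex (i + 1) - P.vertex i‖⁻¹ • (P.vertex (i + 1) - P.vertex i)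

/-- The unit normal of edge `i` that points to the inner side. -/
def inwardNormal (i : ZMod n) : Plane := !₂[-(P.dir i 1), P.dir i 0]

/-- The edge vector of edge `i`, in space. -/
def edgeVec (i : ZMod n) : Space := lift (P.dir i) 0

/-- The slope vector of edge `i`: the unit vector orthogonal to the edge, above the inner side,
at an angle of `π / 4` with the `xy`-plane. -/
def slopeVec (i : ZMod n) : Space := (Real.sqrt 2)⁻¹ • lift (P.inwardNormal i) 1

/-- Vertex `i` is reflex: its interior angle exceeds `π`. -/
def IsReflex (i : ZMod n) : Prop := cross (P.dir (i - 1)) (P.dir i) < 0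

/-- The velocity of the motorcycle of a reflex vertex `i`. If `θ` is the interior angle, this is the
vector of length `1 / sin (θ / 2)` along the inner bisector; equivalently it is the
vector that has inner product `1` with the inward unit normals of both edges at `i`. -/
def velocity (i : ZMod n) : Plane :=
  (1 + inner ℝ (P.inwardNormal (i - 1)) (P.inwardNormal i))⁻¹ •
    (P.inwardNormal (i - 1) + P.inwardNormal i)

/-- The position of the motorcycle of vertex `i` at time `t`. -/
def ride (i : ZMod n) (t : ℝ) : Plane := P.vertex i + t • P.velocity i

/-- Given the crash times `T`, the motorcycle of `i` meets an obstacle at time `t`: an edge of the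
polygon, or a point of the track of another motorcycle `j`, which passed there at a
time `s ≤ t` (and not after its own crash). -/
def Obstructed (T : ZMod n → ℝ) (i : ZMod n) (t : ℝ) : Prop :=
  P.ride i t ∈ P.boundary ∨
    ∃ j, j ≠ i ∧ P.IsReflex j ∧ ∃ s, 0 ≤ s ∧ s ≤ T j ∧ s ≤ t ∧ P.ride j s = P.ride i t

end SimplePolygon

/-! ## The induced motorcycle graph, slabs, and the straight skeleton roof -/

/-- The motorcycle graph induced by `P`: each motorcycle crashes at the first positive time at
which it meets an obstacle. The values of `crashTime` at non-reflex vertices are irrelevant. -/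
structure MotorcycleGraph {n : ℕ} [NeZero n] (P : SimplePolygon n) where
  crashTime : ZMod n → ℝ
  crashTime_pos : ∀ i, P.IsReflex i → 0 < crashTime i
  crash : ∀ i, P.IsReflex i → P.Obstructed crashTime i (crashTime i)
  free : ∀ i, P.IsReflex i → ∀ t, 0 < t → t < crashTime i → ¬ P.Obstructed crashTime i t

namespace MotorcycleGraph

variable {n : ℕ} [NeZero n] {P : SimplePolygon n} (M : MotorcycleGraph P)

/-- The lifted motorcycle track of vertex `i`; empty if `i` is not reflex. -/
def track (i : ZMod n) : Set Space :=
  {x | P.IsReflex i ∧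
    x ∈ segment ℝ (lift (P.vertex i) 0) (lift (P.ride i (M.crashTime i)) (M.crashTime i))}

/-- The slab of edge `i`: the union of its edge slab and of its motorcycle slabs. -/
def slab (i : ZMod n) : Set Space :=
  {x | ∃ p ∈ segment ℝ (lift (P.vertex i) 0) (lift (P.vertex (i + 1)) 0) ∪
      M.track i ∪ M.track (i + 1), ∃ t : ℝ, 0 ≤ t ∧ x = p + t • P.slopeVec i}

/-- No two motorcycles crash at the same place and time. -/
def NonDegenerate : Prop :=
  ∀ i j, P.IsReflex i → P.IsReflex j → i ≠ j → M.crashTime i = M.crashTime j →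
    P.ride i (M.crashTime i) ≠ P.ride j (M.crashTime j)

/-- Any two slabs meet in a subset of a line. -/
def GeneralPosition : Prop :=
  ∀ i j, i ≠ j → Collinear ℝ (M.slab i ∩ M.slab j)

/-- The face of edge `i` in the straight skeleton roof: the (closed) part of the slab of `i` that
lies above the interior of the polygon and on the lower envelope of all slabs. -/
def roofFace (i : ZMod n) : Set Space :=
  closure {x | x ∈ M.slab i ∧ proj x ∈ P.interior ∧
    ∀ j, ∀ y ∈ M.slab j, proj y = proj x → x 2 ≤ y 2}

/-- The segment from `a` to `b` is an edge of the straight skeleton roof between the faces of the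
edges `i` and `j`: a maximal nondegenerate segment in their intersection. -/
def IsRoofEdge (i j : ZMod n) (a b : Space) : Prop :=
  a ≠ b ∧ segment ℝ a b ⊆ M.roofFace i ∩ M.roofFace j ∧
    ∀ a' b' : Space, segment ℝ a b ⊆ segment ℝ a' b' →
      segment ℝ a' b' ⊆ M.roofFace i ∩ M.roofFace j → segment ℝ a' b' = segment ℝ a b

end MotorcycleGraph

/-! ## Surfaces glued from polygons -/

/-- An oriented surface glued from `k` polygons, as a doubly-connected edge list. A dart is a side
of a polygon, directed along the orientation of the polygon; `next` is the following side of the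
same polygon, so that the polygons are the cycles of `next`. The side `d` is glued to the side
`twin d`, with opposite direction; `twin d = d` means that `d` is not glued to anything. -/
structure GluedSurface (k : ℕ) where
  Dart : Type
  [fintypeDart : Fintype Dart]
  next : Equiv.Perm Dart
  face : Dart → Fin k
  face_surjective : Function.Surjective face
  face_eq_iff : ∀ d d', face d = face d' ↔ next.SameCycle d d'
  twin : Dart → Dart
  twin_twin : ∀ d, twin (twin d) = d

namespace GluedSurface

variable {k : ℕ} (R : GluedSurface k)

instance : Fintype R.Dart := R.fintypeDart

/-- `d` is a boundary edge of the surface. -/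
def IsBoundary (d : R.Dart) : Prop := R.twin d = d

/-- Darts with the same starting vertex on the surface: the identifications of corners that are
forced by the gluing of the sides, where the end of `d` (the start of `next d`) becomes
the start of `twin d`. -/
def vertexSetoid : Setoid R.Dart :=
  Relation.EqvGen.setoid fun a b => ∃ d, ¬ R.IsBoundary d ∧ a = R.next d ∧ b = R.twin d

/-- The vertices of the glued surface. -/
def Vertex : Type := Quotient R.vertexSetoid

/-- The vertex of the surface at which `d` starts; `d` ends at `R.vertex (R.next d)`. -/
def vertex (d : R.Dart) : R.Vertex := Quotient.mk R.vertexSetoid d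

def edgeSetoid : Setoid R.Dart where
  r a b := b = a ∨ b = R.twin a
  iseqv :=
    { refl := fun _ => Or.inl rfl
      symm := by
        rintro a b (h | h)
        · exact Or.inl h.symm
        · exact Or.inr (by rw [h, R.twin_twin])
      trans := by
        rintro a b c (rfl | rfl) (rfl | rfl)
        · exact Or.inl rfl
        · exact Or.inr rfl
        · exact Or.inr rfl
        · exact Or.inl (R.twin_twin a) }

/-- The edges of the glued surface. -/
def Edge : Type := Quotient R.edgeSetoid

def edge (d : R.Dart) : R.Edge := Quotient.mk R.edgeSetoid d

/-- The number of edges at a vertex (with multiplicity). A glued edge leaves each of its two ends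
along one of its darts; a boundary edge has only one dart. -/
def degree (v : R.Vertex) : ℕ :=
  Nat.card {d : R.Dart // R.vertex d = v} +
    Nat.card {d : R.Dart // R.IsBoundary d ∧ R.vertex (R.next d) = v}

open Classical in
/-- `c` is a set of edges (a chain mod 2) that meets every vertex in an even number of ends. -/
def IsCycle (c : R.Edge → ZMod 2) : Prop :=
  ∀ v : R.Vertex,
    (∑ d : R.Dart, if R.vertex d = v then c (R.edge d) else 0) +
      (∑ d : R.Dart, if R.IsBoundary d ∧ R.vertex (R.next d) = v then c (R.edge d) else 0) = 0

open Classical in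
/-- `c` is the boundary (mod 2) of the set of faces `A`. -/
def IsBoundaryOf (c : R.Edge → ZMod 2) (A : Fin k → ZMod 2) : Prop :=
  ∀ d : R.Dart, c (R.edge d) =
    if R.IsBoundary d then A (R.face d) else A (R.face d) + A (R.face (R.twin d))

/-- The surface is a disk: it is connected, has a nonempty boundary, and its first homology (mod 2)
vanishes, that is, every cycle of edges bounds a set of faces. (By the classification of
surfaces, the disk is the only compact surface with these properties.) -/
def IsDisk : Prop :=
  (∀ d d' : R.Dart, Relation.EqvGen (fun a b => b = R.next a ∨ b = R.twin a) d d') ∧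
  (∃ d, R.IsBoundary d) ∧
  ∀ c, R.IsCycle c → ∃ A, R.IsBoundaryOf c A

/-- The combinatorial complexity: the total number of vertices, edges and faces. -/
def complexity : ℕ := Nat.card R.Vertex + Nat.card R.Edge + k

end GluedSurface

/-! ## Partial roofs -/

/-- Space, extended by one point at infinity for each unit vector. -/
inductive ExtPoint where
  | finite (x : Space) : ExtPoint
  | infinite (u : {u : Space // ‖u‖ = 1}) : ExtPoint

/-- The points of space on the straight edge between two extended points: a segment or a ray. (No
edge of a face joins two points at infinity.) -/
def ExtPoint.join : ExtPoint → ExtPoint → Set Space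
  | .finite x, .finite y => segment ℝ x y
  | .finite x, .infinite u => {z | ∃ t : ℝ, 0 ≤ t ∧ z = x + t • (u : Space)}
  | .infinite u, .finite x => {z | ∃ t : ℝ, 0 ≤ t ∧ z = x + t • (u : Space)}
  | .infinite _, .infinite _ => ∅

/-- The edge between two extended points is parallel to `S`, and if it is unbounded then it goes to
infinity in the direction of `S`. -/
def ExtPoint.AlongSlope (S : Space) : ExtPoint → ExtPoint → Prop
  | .finite x, .finite y => ∃ t : ℝ, y = x + t • S
  | .finite _, .infinite u => (u : Space) = S
  | .infinite u, .finite _ => (u : Space) = S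
  | .infinite _, .infinite _ => False

/-- The part of the boundary of a face to which an edge of the face belongs. The slab border chain
consists of `motorcycleLeft`, `base`, `motorcycleRight`. -/
inductive EdgeKind where
  | base
  | motorcycleRight
  | interiorRight
  | slope
  | interiorLeft
  | motorcycleLeft
  deriving DecidableEq

/-- The order in which the parts occur along a face, counter-clockwise from the base edge. -/
def EdgeKind.rank : EdgeKind → ℕ
  | .base => 0
  | .motorcycleRight => 1
  | .interiorRight => 2
  | .slope => 3
  | .interiorLeft => 4
  | .motorcycleLeft => 5

/-- A surface glued from `k` faces, one for each edge `start, …, start + k - 1` of the polygon, each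
face being a simple, possibly unbounded, polygon on the slab of its edge, with a base
edge, at most two motorcycle edges, two (possibly trivial) interior chains and at most
two slope edges. -/
structure SlabSurface {n : ℕ} [NeZero n] {P : SimplePolygon n} (M : MotorcycleGraph P)
    (start : ZMod n) (k : ℕ) extends GluedSurface k where
  /-- The (canonically realized) starting point of a dart. -/
  pos : Dart → ExtPoint
  /-- Glued sides are the same edge in space. -/
  pos_twin : ∀ d, twin d ≠ d → pos (twin d) = pos (next d)
  kind : Dart → EdgeKind
  base : Fin k → Dart
  face_base : ∀ i, face (base i) = i
  kind_eq_base_iff : ∀ d, kind d = .base ↔ d = base (face d)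
  /-- Each face is made up of its chains, in the order given by `EdgeKind.rank`. -/
  kind_next : ∀ d, kind (next d) = .base ∨ (kind d).rank ≤ (kind (next d)).rank
  /-- The faces are simple polygons. -/
  pos_injective : ∀ d d', face d = face d' → pos d = pos d' → d = d'
  simple : ∀ d d', face d = face d' → d ≠ d' →
    ∀ x ∈ (pos d).join (pos (next d)) ∩ (pos d').join (pos (next d')),
      (d' = next d ∧ pos d' = .finite x) ∨ (d = next d' ∧ pos d = .finite x)
  /-- The faces lie on their slabs. -/
  subset_slab : ∀ d, (pos d).join (pos (next d)) ⊆ M.slab (start + (face d : ℕ))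
  /-- The base edge of a face is the base edge of its slab. -/
  pos_base : ∀ i : Fin k, pos (base i) = .finite (lift (P.vertex (start + (i : ℕ))) 0)
  pos_next_base : ∀ i : Fin k,
    pos (next (base i)) = .finite (lift (P.vertex (start + (i : ℕ) + 1)) 0)
  /-- Motorcycle edges lie on the lifted tracks at the two ends of the base edge. -/
  motorcycleLeft_subset : ∀ d, kind d = .motorcycleLeft →
    (pos d).join (pos (next d)) ⊆ M.track (start + (face d : ℕ))
  motorcycleRight_subset : ∀ d, kind d = .motorcycleRight →
    (pos d).join (pos (next d)) ⊆ M.track (start + (face d : ℕ) + 1)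
  /-- The interior chains have finite vertices and are monotone with respect to the base edge. (In
  counter-clockwise order, the left chain too is passed from right to left.) -/
  interior_monotone : ∀ d, kind d = .interiorLeft ∨ kind d = .interiorRight →
    ∃ x y, pos d = .finite x ∧ pos (next d) = .finite y ∧
      inner ℝ (P.edgeVec (start + (face d : ℕ))) y ≤ inner ℝ (P.edgeVec (start + (face d : ℕ))) x
  /-- The two interior chains overlap at most vertically at their terminal points. -/
  interior_separate : ∀ d d', face d = face d' → kind d = .interiorRight →
    kind d' = .interiorLeft → ∀ x y, pos (next d) = .finite x → pos d' = .finite y →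
      inner ℝ (P.edgeVec (start + (face d : ℕ))) y ≤ inner ℝ (P.edgeVec (start + (face d : ℕ))) x
  /-- There are at most two slope edges on a face, parallel to its slope vector. -/
  slope_along : ∀ d, kind d = .slope →
    (pos d).AlongSlope (P.slopeVec (start + (face d : ℕ))) (pos (next d))
  slope_le_two : ∀ i, Nat.card {d : Dart // face d = i ∧ kind d = .slope} ≤ 2

namespace SlabSurface

variable {n : ℕ} [NeZero n] {P : SimplePolygon n} {M : MotorcycleGraph P}
  {start : ZMod n} {k : ℕ} (R : SlabSurface M start k)

/-- The realization of an edge. -/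
def edgeSet (d : R.Dart) : Set Space := (R.pos d).join (R.pos (R.next d))

/-- The realization of a face: the interior chains and the slope edges of the face subdivide its
slab; the face is the (closed) part that contains the base edge. -/
def faceSet (i : Fin k) : Set Space :=
  closure (connectedComponentIn
    (M.slab (start + (i : ℕ)) \ ⋃ d ∈ {d : R.Dart | R.face d = i ∧
      (R.kind d = .interiorLeft ∨ R.kind d = .interiorRight ∨ R.kind d = .slope)}, R.edgeSet d)
    (midpoint ℝ (lift (P.vertex (start + (i : ℕ))) 0) (lift (P.vertex (start + (i : ℕ) + 1)) 0)))

/-- Each face is monotone with respect to the base edge of its slab: every line orthogonal to the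
base edge meets the face in a connected set. -/
def FaceMonotonicity : Prop :=
  ∀ (i : Fin k) (c : ℝ),
    IsPreconnected (R.faceSet i ∩ {x | inner ℝ (P.edgeVec (start + (i : ℕ))) x = c})

/-- Each face contains the face of the straight skeleton roof on the same slab. -/
def FaceContainment : Prop := ∀ i : Fin k, M.roofFace (start + (i : ℕ)) ⊆ R.faceSet i

/-- Each edge of the straight skeleton roof between two slabs of the chain is contained in an edge
of the surface between the two corresponding faces. -/
def EdgeContainment : Prop :=
  ∀ i j : Fin k, i ≠ j → ∀ a b,
    M.IsRoofEdge (start + (i : ℕ)) (start + (j : ℕ)) a b →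
      ∃ d, R.face d = i ∧ ¬ R.IsBoundary d ∧ R.face (R.twin d) = j ∧ segment ℝ a b ⊆ R.edgeSet d

/-- A fringe edge: a boundary edge that is not a base edge. -/
def IsFringe (d : R.Dart) : Prop := R.IsBoundary d ∧ R.kind d ≠ .base

/-- The boundary property. -/
structure BoundaryProperty : Prop where
  /-- The base edges are boundary edges and form a chain: base edges that are
  consecutive along the polygon are consecutive along the boundary. -/
  base_boundary : ∀ i, R.IsBoundary (R.base i)
  base_chain : ∀ i j : Fin k, start + ((i : ℕ) : ZMod n) + 1 = start + ((j : ℕ) : ZMod n) →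
    R.vertex (R.next (R.base i)) = R.vertex (R.base j)
  /-- The remaining boundary edges form a chain. -/
  fringe_chain : ∀ d d', R.IsFringe d → R.IsFringe d' →
    Relation.EqvGen
      (fun a b => R.IsFringe a ∧ R.IsFringe b ∧ R.vertex (R.next a) = R.vertex b) d d'
  interior_internal : ∀ d, R.kind d = .interiorLeft ∨ R.kind d = .interiorRight →
    ¬ R.IsBoundary d
  slope_fringe : ∀ d, R.kind d = .slope → R.IsBoundary d
  /-- A motorcycle edge is on the fringe iff the defining chain ends at the
  endpoint of the base edge from which the motorcycle edge emanates. -/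
  motorcycleLeft_fringe_iff : ∀ d, R.kind d = .motorcycleLeft →
    (R.IsBoundary d ↔ ∀ j, R.vertex (R.next (R.base j)) ≠ R.vertex (R.base (R.face d)))
  motorcycleRight_fringe_iff : ∀ d, R.kind d = .motorcycleRight →
    (R.IsBoundary d ↔ ∀ j, R.vertex (R.base j) ≠ R.vertex (R.next (R.base (R.face d))))

/-- No edge is subdivided needlessly: there is no vertex of degree two whose two edges lie on a
common line. -/
def NoSuperfluousVertex : Prop :=
  ∀ d, R.degree (R.vertex (R.next d)) = 2 →
    ¬ Collinear ℝ (R.edgeSet d ∪ R.edgeSet (R.next d))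

end SlabSurface

/-- A partial roof for the chain of the `k` consecutive edges `start, …, start + k - 1`. -/
structure PartialRoof {n : ℕ} [NeZero n] {P : SimplePolygon n} (M : MotorcycleGraph P)
    (start : ZMod n) (k : ℕ) extends SlabSurface M start k where
  isDisk : toGluedSurface.IsDisk
  faceMonotonicity : toSlabSurface.FaceMonotonicity
  faceContainment : toSlabSurface.FaceContainment
  edgeContainment : toSlabSurface.EdgeContainment
  boundaryProperty : toSlabSurface.BoundaryProperty
  noSuperfluousVertex : toSlabSurface.NoSuperfluousVertex

end

end StraightSkeleton

/-! The bound is an Euler-type count. Write V, E, D, B for the numbers of vertices, edges, darts and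
boundary darts.

On a disk every mod 2 cycle bounds a set of faces, so the cycle space has dimension at most k, and
rank-nullity for the boundary map gives E ≤ V + k (`IsDisk.card_edge_le`).

A vertex at which no boundary edge ends has degree at least 3 (`three_le_degree`). Otherwise a face
is glued to itself, which simplicity of the polygons forbids, or both edges at the vertex separate
the same two faces. In the latter case they lie in the intersection of two slabs, hence on a line,
and the vertex is superfluous. Double counting then gives 3V ≤ D + 2B and D + B ≤ 2E.

Finally B ≤ 5k (`card_isBoundary_le`): a face contributes at most its base, two slope edges and one
motorcycle edge on each side, since consecutive boundary edges on one track would again be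
collinear.

Together, 3V ≤ 2E + B ≤ 2V + 7k, so V ≤ 7k, E ≤ 8k, and the complexity is at most 16k. -/

namespace StraightSkeleton

/-! ### Combinatorics of glued surfaces. -/

namespace GluedSurface

variable {k : ℕ} (R : GluedSurface k)

instance : Finite R.Vertex := Quotient.finite _

instance : Finite R.Edge := Quotient.finite _

theorem face_next (d : R.Dart) : R.face (R.next d) = R.face d :=
  (R.face_eq_iff _ _).2 (Equiv.Perm.sameCycle_apply_left.2 (Equiv.Perm.SameCycle.refl _ _))

theorem edge_eq_iff (d d' : R.Dart) : R.edge d = R.edge d' ↔ d' = d ∨ d' = R.twin d :=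
  Quotient.eq (r := R.edgeSetoid)

theorem isBoundary_twin_iff (d : R.Dart) : R.IsBoundary (R.twin d) ↔ R.IsBoundary d := by
  unfold IsBoundary
  rw [R.twin_twin]
  exact eq_comm

theorem vertex_next_eq_vertex_twin {d : R.Dart} (hd : ¬ R.IsBoundary d) :
    R.vertex (R.next d) = R.vertex (R.twin d) :=
  Quotient.sound (Relation.EqvGen.rel _ _ ⟨d, hd, rfl, rfl⟩)

/-- A corner between two boundary edges is not identified with any other corner. -/
theorem eq_next_of_vertex_eq {d d' : R.Dart} (hd : R.IsBoundary d) (hn : R.IsBoundary (R.next d))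
    (h : R.vertex d' = R.vertex (R.next d)) : d' = R.next d := by
  -- A generating identification pairs `next e` with `twin e` for a glued `e`. Neither can be `next
  -- d`: the first because `d` is boundary, the second because `next d` is.
  have key : ∀ a b, Relation.EqvGen
      (fun a b => ∃ d, ¬ R.IsBoundary d ∧ a = R.next d ∧ b = R.twin d) a b →
      (a = R.next d ↔ b = R.next d) := by
    intro a b hab
    induction hab with
    | rel a b h =>
      obtain ⟨e, he, rfl, rfl⟩ := h
      constructor
      · intro h
        rw [R.next.injective h] at he
        exact absurd hd he
      · intro h
        rw [← h, R.isBoundary_twin_iff] at hn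
        exact absurd hn he
    | refl => rfl
    | symm _ _ _ ih => exact ih.symm
    | trans _ _ _ _ _ ih₁ ih₂ => exact ih₁.trans ih₂
  exact (key _ _ (Quotient.exact h)).2 rfl

theorem degree_eq_two_of_isBoundary {d : R.Dart} (hd : R.IsBoundary d)
    (hn : R.IsBoundary (R.next d)) : R.degree (R.vertex (R.next d)) = 2 := by
  have h₁ : Nat.card {e : R.Dart // R.vertex e = R.vertex (R.next d)} = 1 := by
    rw [Nat.card_eq_one_iff_unique]
    exact ⟨⟨fun a b => Subtype.ext ((R.eq_next_of_vertex_eq hd hn a.2).trans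
      (R.eq_next_of_vertex_eq hd hn b.2).symm)⟩, ⟨⟨R.next d, rfl⟩⟩⟩
  have h₂ : Nat.card {e : R.Dart // R.IsBoundary e ∧
      R.vertex (R.next e) = R.vertex (R.next d)} = 1 := by
    rw [Nat.card_eq_one_iff_unique]
    exact ⟨⟨fun a b => Subtype.ext (R.next.injective
      ((R.eq_next_of_vertex_eq hd hn a.2.2).trans (R.eq_next_of_vertex_eq hd hn b.2.2).symm))⟩,
      ⟨⟨d, hd, rfl⟩⟩⟩
  rw [degree, h₁, h₂]

/-! ### Mod 2 homology and the Euler inequality. -/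

open Classical in
/-- The boundary map from edges to vertices, mod 2. -/
noncomputable def boundaryMap : (R.Edge → ZMod 2) →ₗ[ZMod 2] (R.Vertex → ZMod 2) where
  toFun c v :=
    (∑ d : R.Dart, if R.vertex d = v then c (R.edge d) else 0) +
      (∑ d : R.Dart, if R.IsBoundary d ∧ R.vertex (R.next d) = v then c (R.edge d) else 0)
  map_add' c c' := by
    funext v
    simp only [Pi.add_apply, ← Finset.sum_filter, Finset.sum_add_distrib]
    abel
  map_smul' a c := by
    funext v
    simp only [Pi.smul_apply, smul_eq_mul, ← Finset.sum_filter, ← Finset.mul_sum, mul_add,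
      RingHom.id_apply]

/-- Rank-nullity: the rank of `boundaryMap` is at most the number of vertices, and its kernel, the
cycle space, embeds into the sets of faces. -/
theorem IsDisk.card_edge_le {R : GluedSurface k} (h : R.IsDisk) :
    Nat.card R.Edge ≤ Nat.card R.Vertex + k := by
  classical
  have := Fintype.ofFinite R.Edge
  have := Fintype.ofFinite R.Vertex
  have hc : ∀ c : LinearMap.ker R.boundaryMap, ∃ A, R.IsBoundaryOf c.1 A := fun c =>
    h.2.2 c.1 fun v => congrFun (LinearMap.mem_ker.1 c.2) v
  choose A hA using hc
  -- A cycle is determined by any set of faces that it bounds, so an arbitrary choice of bounding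
  -- sets is injective; no linearity is needed.
  have hinj : Function.Injective A := by
    intro c c' hcc
    refine Subtype.ext (funext fun e => ?_)
    obtain ⟨d, rfl⟩ := Quotient.exists_rep e
    exact (hA c d).trans (hcc ▸ (hA c' d).symm)
  have hker : Module.finrank (ZMod 2) (LinearMap.ker R.boundaryMap) ≤ k := by
    have h₁ := Nat.card_le_card_of_injective A hinj
    rw [Module.natCard_eq_pow_finrank (K := ZMod 2)] at h₁
    simp only [Nat.card_eq_fintype_card, ZMod.card, Fintype.card_fun, Fintype.card_fin] at h₁
    exact (Nat.pow_le_pow_iff_right (by norm_num)).1 h₁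
  have h₂ := LinearMap.finrank_range_add_finrank_ker R.boundaryMap
  have h₃ := Submodule.finrank_le (LinearMap.range R.boundaryMap)
  rw [Module.finrank_fintype_fun_eq_card] at h₂ h₃
  rw [Nat.card_eq_fintype_card, Nat.card_eq_fintype_card]
  omega

/-! ### Double counting of darts. -/

theorem sum_card_fiber {α β : Type*} [Finite α] [Fintype β] (p : α → Prop) (f : α → β) :
    ∑ b, Nat.card {a // p a ∧ f a = b} = Nat.card {a // p a} := by
  classical
  have := Fintype.ofFinite α
  simp only [Nat.card_eq_fintype_card, Fintype.card_subtype]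
  rw [Finset.card_eq_sum_card_fiberwise (f := f) (t := Finset.univ) (fun _ _ => Finset.mem_univ _)]
  simp only [Finset.filter_filter]

/-- A glued edge consists of two darts, a boundary edge of one dart that is counted twice. -/
theorem card_dart_add_card_boundary_le :
    Nat.card R.Dart + Nat.card {d // R.IsBoundary d} ≤ 2 * Nat.card R.Edge := by
  classical
  have := Fintype.ofFinite R.Edge
  have h₁ := sum_card_fiber (fun _ => True) R.edge
  have h₂ := sum_card_fiber R.IsBoundary R.edge
  have h₃ : ∀ e, Nat.card {d // True ∧ R.edge d = e} +
      Nat.card {d // R.IsBoundary d ∧ R.edge d = e} ≤ 2 := by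
    intro e
    obtain ⟨d, rfl⟩ := Quotient.exists_rep e
    change Nat.card {d' // True ∧ R.edge d' = R.edge d} +
      Nat.card {d' // R.IsBoundary d' ∧ R.edge d' = R.edge d} ≤ 2
    have h : ∀ d', R.edge d' = R.edge d ↔ d' = d ∨ d' = R.twin d := fun d' => by
      rw [eq_comm, R.edge_eq_iff]
    simp only [h, true_and, Nat.card_eq_fintype_card, Fintype.card_subtype]
    by_cases hd : R.IsBoundary d
    · have hs : ∀ p : R.Dart → Prop, (Finset.univ.filter fun d' => p d' ∧
          (d' = d ∨ d' = R.twin d)).card ≤ 1 := fun p =>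
        (Finset.card_le_card (t := {d}) fun x hx => by
          have hx' := (Finset.mem_filter.1 hx).2.2
          rw [hd, or_self] at hx'
          exact Finset.mem_singleton.2 hx').trans_eq (Finset.card_singleton d)
      have a := hs fun _ => True
      have b := hs R.IsBoundary
      simp only [true_and] at a
      omega
    · have a : (Finset.univ.filter fun d' => d' = d ∨ d' = R.twin d).card ≤ 2 :=
        (Finset.card_le_card (t := {d, R.twin d}) fun x hx => by
          simpa using hx).trans Finset.card_le_two
      have b : (Finset.univ.filter fun d' => R.IsBoundary d' ∧
          (d' = d ∨ d' = R.twin d)) = ∅ := by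
        refine Finset.filter_eq_empty_iff.2 ?_
        rintro x - ⟨hx, rfl | rfl⟩
        · exact hd hx
        · exact hd ((R.isBoundary_twin_iff d).1 hx)
      rw [b, Finset.card_empty]
      exact a
  have h₄ := Finset.sum_le_sum fun e (_ : e ∈ Finset.univ) => h₃ e
  rw [Finset.sum_add_distrib, h₁, h₂, Finset.sum_const, Finset.card_univ, smul_eq_mul,
    Nat.card_congr (Equiv.subtypeUnivEquiv fun _ => trivial)] at h₄
  rw [Nat.card_eq_fintype_card (α := R.Edge)]
  omega

/-- Two sides of an interior vertex: if fewer than three darts start at a vertex where no boundary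
edge ends, then two faces meet along both edges at that vertex, or one side is glued to the next. -/
theorem exists_of_degree_lt_three {v : R.Vertex} (hv : R.degree v < 3)
    (hb : ∀ d, R.IsBoundary d → R.vertex (R.next d) ≠ v) :
    ∃ d, R.vertex (R.next d) = v ∧ ¬ R.IsBoundary d ∧ (R.twin d = R.next d ∨
      R.degree v = 2 ∧ R.next (R.twin (R.next d)) = R.twin d) := by
  classical
  have hdeg : R.degree v = Nat.card {d : R.Dart // R.vertex d = v} := by
    have : IsEmpty {d : R.Dart // R.IsBoundary d ∧ R.vertex (R.next d) = v} :=
      ⟨fun x => hb x.1 x.2.1 x.2.2⟩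
    rw [degree, Nat.card_of_isEmpty (α := {d : R.Dart // _ ∧ _}), add_zero]
  obtain ⟨a, rfl⟩ : ∃ a, R.vertex a = v := Quotient.exists_rep v
  obtain ⟨d, rfl⟩ := R.next.surjective a
  have hd : ¬ R.IsBoundary d := fun h => hb d h rfl
  refine ⟨d, rfl, hd, or_iff_not_imp_left.2 fun hne => ?_⟩
  have htw := R.vertex_next_eq_vertex_twin hd
  -- Rotate about the vertex: `e` precedes `twin d` on its face and ends at the same vertex, so
  -- `twin e` starts there. As only `next d` and `twin d` start there, `twin e` must be `next d`.
  obtain ⟨e, he⟩ := R.next.surjective (R.twin d)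
  have hev : R.vertex (R.next e) = R.vertex (R.next d) := by rw [he, htw]
  have heb : ¬ R.IsBoundary e := fun h => hb e h hev
  have hte : R.vertex (R.twin e) = R.vertex (R.next d) := by
    rw [← R.vertex_next_eq_vertex_twin heb, hev]
  rw [hdeg, Nat.card_eq_fintype_card, Fintype.card_subtype] at hv ⊢
  have hpair : ({R.next d, R.twin d} : Finset R.Dart) ⊆
      Finset.univ.filter fun x => R.vertex x = R.vertex (R.next d) := by
    intro x hx
    rcases Finset.mem_insert.1 hx with rfl | hx
    · simp
    · rw [Finset.mem_singleton.1 hx]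
      simpa using htw.symm
  have h2 : ({R.next d, R.twin d} : Finset R.Dart).card = 2 :=
    Finset.card_pair fun h => hne h.symm
  have heq := Finset.eq_of_subset_of_card_le hpair (by omega)
  have hmem : R.twin e ∈ ({R.next d, R.twin d} : Finset R.Dart) := by
    rw [heq]
    simpa using hte
  have hmem' : R.twin e = R.next d := by
    rcases Finset.mem_insert.1 hmem with h | h
    · exact h
    · have h' : e = d := by
        rw [← R.twin_twin e, Finset.mem_singleton.1 h, R.twin_twin]
      exact absurd (h' ▸ he).symm hne
  rw [← heq]
  exact ⟨h2, by rw [← hmem', R.twin_twin, he]⟩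

/-- Each vertex is charged one per dart starting there and two per boundary dart ending there. If a
boundary dart `d` ends there, `d` pays 2 and `next d` pays 1; otherwise the charge is the degree. -/
theorem three_mul_card_vertex_le
    (h : ∀ v, (∀ d, R.IsBoundary d → R.vertex (R.next d) ≠ v) → 3 ≤ R.degree v) :
    3 * Nat.card R.Vertex ≤ Nat.card R.Dart + 2 * Nat.card {d // R.IsBoundary d} := by
  classical
  have := Fintype.ofFinite R.Vertex
  have h₁ := sum_card_fiber (fun _ => True) R.vertex
  have h₂ := sum_card_fiber R.IsBoundary fun d => R.vertex (R.next d)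
  have h₃ : ∀ v, 3 ≤ Nat.card {d // True ∧ R.vertex d = v} +
      2 * Nat.card {d // R.IsBoundary d ∧ R.vertex (R.next d) = v} := by
    intro v
    have hv := h v
    rw [degree] at hv
    simp only [true_and]
    by_cases hb : ∃ d, R.IsBoundary d ∧ R.vertex (R.next d) = v
    · obtain ⟨d, hd, hdv⟩ := hb
      have a : 0 < Nat.card {d // R.IsBoundary d ∧ R.vertex (R.next d) = v} :=
        Nat.card_pos_iff.2 ⟨⟨⟨d, hd, hdv⟩⟩, inferInstance⟩
      have b : 0 < Nat.card {d // R.vertex d = v} :=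
        Nat.card_pos_iff.2 ⟨⟨⟨R.next d, hdv⟩⟩, inferInstance⟩
      omega
    · have := hv fun d hd hdv => hb ⟨d, hd, hdv⟩
      omega
  have h₄ := Finset.sum_le_sum fun v (_ : v ∈ Finset.univ) => h₃ v
  rw [Finset.sum_add_distrib, ← Finset.mul_sum, h₁, h₂, Finset.sum_const, Finset.card_univ,
    smul_eq_mul, Nat.card_congr (Equiv.subtypeUnivEquiv fun _ => trivial)] at h₄
  rw [Nat.card_eq_fintype_card (α := R.Vertex)]
  omega

end GluedSurface

/-! ### Geometry of edges, rays and tracks. -/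

theorem lift_injective {q q' : Plane} {z z' : ℝ} (h : lift q z = lift q' z') : q = q' := by
  ext i
  fin_cases i
  · simpa [lift] using congrArg (fun x : Space => x 0) h
  · simpa [lift] using congrArg (fun x : Space => x 1) h

namespace ExtPoint

theorem join_comm (p q : ExtPoint) : p.join q = q.join p := by
  rcases p with x | u <;> rcases q with y | w
  · exact segment_symm ℝ x y
  all_goals rfl

theorem ray_not_isBounded (x : Space) (u : {u : Space // ‖u‖ = 1}) :
    ¬ Bornology.IsBounded {z : Space | ∃ t : ℝ, 0 ≤ t ∧ z = x + t • (u : Space)} := by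
  intro h
  obtain ⟨C, hC⟩ := h.exists_norm_le
  have hC0 : 0 ≤ C := (norm_nonneg _).trans (hC x ⟨0, le_rfl, by simp⟩)
  -- By the triangle inequality this point of the ray has norm at least `C + 1`.
  have h₁ := hC (x + (C + ‖x‖ + 1) • (u : Space)) ⟨_, by positivity, rfl⟩
  have h₂ := norm_sub_norm_le ((C + ‖x‖ + 1) • (u : Space)) (-x)
  rw [sub_neg_eq_add, norm_neg, norm_smul, u.2, mul_one, Real.norm_of_nonneg (by positivity),
    add_comm ((C + ‖x‖ + 1) • (u : Space)) x] at h₂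
  linarith

theorem exists_finite_of_isBounded_join {p : ExtPoint} {x : Space}
    (h : Bornology.IsBounded (p.join (.finite x))) : ∃ y, p = .finite y := by
  rcases p with y | u
  · exact ⟨y, rfl⟩
  · exact absurd h (ray_not_isBounded x u)

theorem infinite_join {p q : ExtPoint} (hpq : p ≠ q)
    (h : (∃ x, p = .finite x) ∨ ∃ x, q = .finite x) : (p.join q).Infinite := by
  have ray : ∀ (x : Space) (u : {u : Space // ‖u‖ = 1}),
      {z : Space | ∃ t : ℝ, 0 ≤ t ∧ z = x + t • (u : Space)}.Infinite :=
    fun x u hf => ray_not_isBounded x u hf.isBounded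
  rcases p with x | u <;> rcases q with y | w
  · have hxy : x ≠ y := fun h => hpq (h ▸ rfl)
    change (segment ℝ x y).Infinite
    rw [segment_eq_image_lineMap]
    exact (Set.Icc_infinite zero_lt_one).image (AffineMap.lineMap_injective ℝ hxy).injOn
  · exact ray x w
  · exact ray y u
  · simp at h

end ExtPoint

namespace MotorcycleGraph

variable {n : ℕ} [NeZero n] {P : SimplePolygon n} (M : MotorcycleGraph P)

theorem isBounded_track (i : ZMod n) : Bornology.IsBounded (M.track i) := by
  refine Bornology.IsBounded.subset ?_ fun x hx => hx.2
  rw [segment_eq_image_lineMap]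
  exact (isCompact_Icc.image AffineMap.lineMap_continuous).isBounded

theorem collinear_track (i : ZMod n) : Collinear ℝ (M.track i) := by
  refine (collinear_iff_exists_forall_eq_smul_vadd _).2 ⟨lift (P.vertex i) 0,
    lift (P.ride i (M.crashTime i)) (M.crashTime i) - lift (P.vertex i) 0, fun x hx => ?_⟩
  have h := hx.2
  rw [segment_eq_image'] at h
  obtain ⟨r, -, rfl⟩ := h
  exact ⟨r, add_comm _ _⟩

end MotorcycleGraph

/-- Ensures that distinct faces belong to distinct edges of the polygon, so that general position
applies to their slabs. -/
theorem add_natCast_ne {n k : ℕ} (start : ZMod n) (hk : k ≤ n) {i j : Fin k} (h : i ≠ j) :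
    start + ((i : ℕ) : ZMod n) ≠ start + ((j : ℕ) : ZMod n) := by
  intro h'
  have h₁ := (ZMod.natCast_eq_natCast_iff _ _ _).1 (add_left_cancel h')
  exact h (Fin.ext (Nat.ModEq.eq_of_lt_of_lt h₁ (i.2.trans_le hk) (j.2.trans_le hk)))

/-! ### Faces on slabs: edges are infinite sets, and no face is glued to itself. -/

namespace SlabSurface

variable {n : ℕ} [NeZero n] {P : SimplePolygon n} {M : MotorcycleGraph P}
  {start : ZMod n} {k : ℕ} (R : SlabSurface M start k)

theorem next_ne (d : R.Dart) : R.next d ≠ d := by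
  intro h
  obtain ⟨m, hm⟩ := (R.face_eq_iff d (R.base (R.face d))).1 (R.face_base _).symm
  -- A fixed dart is the whole face, so it is the base edge, whose two ends would then coincide.
  rw [Equiv.Perm.zpow_apply_eq_self_of_apply_eq_self h] at hm
  have h₂ := R.pos_next_base (R.face d)
  rw [← hm, h, hm, R.pos_base, R.face_base] at h₂
  exact P.vertex_ne _ (lift_injective (ExtPoint.finite.inj h₂))

theorem exists_iterate_next_eq (d d' : R.Dart) (h : R.face d = R.face d') :
    ∃ m : ℕ, (R.next ^ m) d = d' :=
  ((R.face_eq_iff d d').1 h).exists_nat_pow_eq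

/-- Lying on a track does not alone exclude two infinite ends, as `join` is then empty. Induction on
the distance to the base edge makes the end of `d` finite, and boundedness of the track then
excludes a ray. -/
theorem exists_pos_eq_finite_of_motorcycleLeft (m : ℕ) : ∀ d : R.Dart,
    R.kind d = .motorcycleLeft → (R.next ^ m) d = R.base (R.face d) →
      ∃ x, R.pos d = .finite x := by
  induction m with
  | zero =>
    intro d hd h
    have := (R.kind_eq_base_iff d).2 h
    simp [hd] at this
  | succ m ih =>
    intro d hd h
    rw [pow_succ, Equiv.Perm.mul_apply, ← R.face_next d] at h
    have hfin : ∃ x, R.pos (R.next d) = .finite x := by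
      rcases R.kind_next d with hb | hr
      · rw [(R.kind_eq_base_iff _).1 hb]
        exact ⟨_, R.pos_base _⟩
      · refine ih _ ?_ h
        rw [hd] at hr
        revert hr
        cases R.kind (R.next d) <;> simp [EdgeKind.rank]
    obtain ⟨x, hx⟩ := hfin
    have hs := R.motorcycleLeft_subset d hd
    rw [hx] at hs
    exact ExtPoint.exists_finite_of_isBounded_join ((M.isBounded_track _).subset hs)

/-- The mirror image, by induction on the distance from the base edge. -/
theorem exists_pos_next_eq_finite_of_motorcycleRight (m : ℕ) : ∀ d : R.Dart,
    R.kind d = .motorcycleRight → (R.next ^ m) (R.base (R.face d)) = d →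
      ∃ x, R.pos (R.next d) = .finite x := by
  induction m with
  | zero =>
    intro d hd h
    have := (R.kind_eq_base_iff d).2 h.symm
    simp [hd] at this
  | succ m ih =>
    intro d hd h
    obtain ⟨e, rfl⟩ := R.next.surjective d
    rw [pow_succ', Equiv.Perm.mul_apply, R.face_next e] at h
    have h := R.next.injective h
    have hfin : ∃ x, R.pos (R.next e) = .finite x := by
      rcases R.kind_next e with hb | hr
      · simp [hd] at hb
      · rw [hd] at hr
        have : R.kind e = .base ∨ R.kind e = .motorcycleRight := by
          revert hr
          cases R.kind e <;> simp [EdgeKind.rank]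
        rcases this with hb | hm
        · rw [(R.kind_eq_base_iff _).1 hb]
          exact ⟨_, R.pos_next_base _⟩
        · exact ih _ hm h
    obtain ⟨x, hx⟩ := hfin
    have hs := R.motorcycleRight_subset _ hd
    rw [hx, ExtPoint.join_comm] at hs
    exact ExtPoint.exists_finite_of_isBounded_join ((M.isBounded_track _).subset hs)

/-- No edge of a face joins two points at infinity. -/
theorem exists_finite_end (d : R.Dart) :
    (∃ x, R.pos d = .finite x) ∨ ∃ x, R.pos (R.next d) = .finite x := by
  cases hd : R.kind d with
  | base =>
    rw [(R.kind_eq_base_iff _).1 hd]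
    exact Or.inl ⟨_, R.pos_base _⟩
  | motorcycleRight =>
    obtain ⟨m, hm⟩ := R.exists_iterate_next_eq (R.base (R.face d)) d (R.face_base _)
    exact Or.inr (R.exists_pos_next_eq_finite_of_motorcycleRight m d hd hm)
  | interiorRight =>
    obtain ⟨x, -, hx, -⟩ := R.interior_monotone d (Or.inr hd)
    exact Or.inl ⟨x, hx⟩
  | slope =>
    have h := R.slope_along d hd
    rcases hp : R.pos d with x | u
    · exact Or.inl ⟨x, rfl⟩
    · rcases hq : R.pos (R.next d) with y | w
      · exact Or.inr ⟨y, rfl⟩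
      · rw [hp, hq] at h
        exact h.elim
  | interiorLeft =>
    obtain ⟨x, -, hx, -⟩ := R.interior_monotone d (Or.inl hd)
    exact Or.inl ⟨x, hx⟩
  | motorcycleLeft =>
    obtain ⟨m, hm⟩ := R.exists_iterate_next_eq d (R.base (R.face d)) (R.face_base _).symm
    exact Or.inl (R.exists_pos_eq_finite_of_motorcycleLeft m d hd hm)

theorem infinite_edgeSet (d : R.Dart) : (R.edgeSet d).Infinite :=
  ExtPoint.infinite_join (fun h => R.next_ne d (R.pos_injective d _ (R.face_next d).symm h).symm)
    (R.exists_finite_end d)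

theorem edgeSet_twin (d : R.Dart) : R.edgeSet (R.twin d) = R.edgeSet d := by
  by_cases hd : R.twin d = d
  · rw [hd]
  · have h := R.pos_twin (R.twin d) (by rw [R.twin_twin]; exact Ne.symm hd)
    rw [R.twin_twin] at h
    rw [edgeSet, edgeSet, R.pos_twin d hd, ← h, ExtPoint.join_comm]

/-- No face is glued to itself. -/
theorem face_twin_ne {d : R.Dart} (hd : ¬ R.IsBoundary d) : R.face (R.twin d) ≠ R.face d := by
  intro hf
  -- Distinct sides of a simple polygon share only common end points, but these two sides coincide
  -- as sets, so the edge would have at most two points.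
  have key : ∀ x ∈ R.edgeSet d, R.pos (R.twin d) = .finite x ∨ R.pos d = .finite x := by
    intro x hx
    rcases R.simple d (R.twin d) hf.symm (fun h => hd h.symm) x
      ⟨hx, (R.edgeSet_twin d).ge hx⟩ with h | h
    · exact Or.inl h.2
    · exact Or.inr h.2
  have hsub : ∀ p : ExtPoint, {x | p = .finite x}.Finite := fun p =>
    Set.Subsingleton.finite fun x hx y hy => ExtPoint.finite.inj (hx.symm.trans hy)
  exact R.infinite_edgeSet d (((hsub _).union (hsub _)).subset key)

theorem edgeSet_subset_slab (d : R.Dart) :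
    R.edgeSet d ⊆ M.slab (start + ((R.face d : ℕ) : ZMod n)) :=
  R.subset_slab d

/-! ### Vertex degrees and boundary edges when no vertex is superfluous. -/

theorem three_le_degree (hgp : M.GeneralPosition) (hk : k ≤ n) (hR : R.NoSuperfluousVertex)
    (v : R.Vertex) (hb : ∀ d, R.IsBoundary d → R.vertex (R.next d) ≠ v) : 3 ≤ R.degree v := by
  by_contra! hv
  obtain ⟨d, rfl, hd, h | ⟨h2, h⟩⟩ := R.exists_of_degree_lt_three hv hb
  · exact R.face_twin_ne hd (by rw [h, R.face_next])
  -- Both edges separate the faces of `d` and `twin d`, hence lie in the intersection of their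
  -- slabs, which is collinear.
  · refine hR d h2 ((hgp _ _ (add_natCast_ne start hk (R.face_twin_ne hd).symm)).subset
      (Set.union_subset ?_ ?_))
    · refine Set.subset_inter (R.edgeSet_subset_slab d) ?_
      rw [← R.edgeSet_twin]
      exact R.edgeSet_subset_slab _
    · refine Set.subset_inter ?_ ?_
      · rw [← R.face_next d]
        exact R.edgeSet_subset_slab _
      · rw [← R.edgeSet_twin, ← h, R.face_next]
        exact R.edgeSet_subset_slab _

/-- Otherwise the preceding edge lies on the same track. The fringe criterion depends only on the
face and the side, so that edge is boundary too, and the two meet in a superfluous vertex of degree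
two. -/
theorem eq_next_base_of_motorcycleRight (hR : R.NoSuperfluousVertex) (hB : R.BoundaryProperty)
    {d : R.Dart} (hd : R.kind d = .motorcycleRight) (hb : R.IsBoundary d) :
    d = R.next (R.base (R.face d)) := by
  obtain ⟨e, rfl⟩ := R.next.surjective d
  have hr := (R.kind_next e).resolve_left (by simp [hd])
  have hek : R.kind e = .base ∨ R.kind e = .motorcycleRight := by
    rw [hd] at hr
    revert hr
    cases R.kind e <;> simp [EdgeKind.rank]
  rcases hek with he | he
  · rw [R.face_next, ← (R.kind_eq_base_iff e).1 he]
  · have heb : R.IsBoundary e := by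
      have h := (hB.motorcycleRight_fringe_iff _ hd).1 hb
      rw [R.face_next] at h
      exact (hB.motorcycleRight_fringe_iff _ he).2 h
    have h₁ := R.motorcycleRight_subset e he
    have h₂ := R.motorcycleRight_subset _ hd
    rw [R.face_next] at h₂
    exact absurd ((M.collinear_track _).subset (Set.union_subset h₁ h₂))
      (hR e (R.degree_eq_two_of_isBoundary heb hb))

theorem next_eq_base_of_motorcycleLeft (hR : R.NoSuperfluousVertex) (hB : R.BoundaryProperty)
    {d : R.Dart} (hd : R.kind d = .motorcycleLeft) (hb : R.IsBoundary d) :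
    R.next d = R.base (R.face d) := by
  rcases R.kind_next d with he | hr
  · rw [← R.face_next d]
    exact (R.kind_eq_base_iff _).1 he
  · have he : R.kind (R.next d) = .motorcycleLeft := by
      rw [hd] at hr
      revert hr
      cases R.kind (R.next d) <;> simp [EdgeKind.rank]
    have heb : R.IsBoundary (R.next d) := by
      have h := (hB.motorcycleLeft_fringe_iff _ hd).1 hb
      rw [← R.face_next] at h
      exact (hB.motorcycleLeft_fringe_iff _ he).2 h
    have h₁ := R.motorcycleLeft_subset d hd
    have h₂ := R.motorcycleLeft_subset _ he
    rw [R.face_next] at h₂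
    exact absurd ((M.collinear_track _).subset (Set.union_subset h₁ h₂))
      (hR d (R.degree_eq_two_of_isBoundary hb heb))

theorem card_isBoundary_le (hR : R.NoSuperfluousVertex) (hB : R.BoundaryProperty) :
    Nat.card {d // R.IsBoundary d} ≤ 5 * k := by
  classical
  have hslope : (Finset.univ.filter fun d => R.kind d = .slope).card ≤ 2 * k := by
    have h₁ := GluedSurface.sum_card_fiber (fun d => R.kind d = .slope) R.face
    have h₂ := Finset.sum_le_sum fun i (_ : i ∈ Finset.univ) => R.slope_le_two i
    simp only [and_comm (a := R.face _ = _)] at h₂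
    rw [h₁, Finset.sum_const, Finset.card_univ, Fintype.card_fin, smul_eq_mul,
      Nat.card_eq_fintype_card, Fintype.card_subtype] at h₂
    omega
  have himage : ∀ f : Fin k → R.Dart, (Finset.univ.image f).card ≤ k := fun f =>
    Finset.card_image_le.trans_eq (by simp)
  -- The summands of 5k: at most 2k slope edges, k base edges, and k darts directly after and k
  -- directly before a base edge.
  have hsub : (Finset.univ.filter R.IsBoundary) ⊆
      (Finset.univ.filter fun d => R.kind d = .slope) ∪ (Finset.univ.image R.base ∪
        (Finset.univ.image (fun i => R.next (R.base i)) ∪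
          Finset.univ.image (fun i => R.next.symm (R.base i)))) := by
    intro d hd
    have hb := (Finset.mem_filter.1 hd).2
    simp only [Finset.mem_union, Finset.mem_filter, Finset.mem_image, Finset.mem_univ, true_and]
    cases hk : R.kind d with
    | base => exact Or.inr (Or.inl ⟨_, ((R.kind_eq_base_iff d).1 hk).symm⟩)
    | motorcycleRight =>
      exact Or.inr (Or.inr (Or.inl ⟨_, (R.eq_next_base_of_motorcycleRight hR hB hk hb).symm⟩))
    | interiorRight => exact absurd hb (hB.interior_internal d (Or.inr hk))
    | slope => exact Or.inl rfl
    | interiorLeft => exact absurd hb (hB.interior_internal d (Or.inl hk))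
    | motorcycleLeft =>
      refine Or.inr (Or.inr (Or.inr ⟨R.face d, ?_⟩))
      rw [← R.next_eq_base_of_motorcycleLeft hR hB hk hb, Equiv.symm_apply_apply]
  rw [Nat.card_eq_fintype_card, Fintype.card_of_subtype (Finset.univ.filter R.IsBoundary) (by simp)]
  have h₁ := himage R.base
  have h₂ := himage fun i => R.next (R.base i)
  have h₃ := himage fun i => R.next.symm (R.base i)
  have h₄ := (Finset.card_le_card hsub).trans ((Finset.card_union_le _ _).trans
    (add_le_add_right ((Finset.card_union_le _ _).trans
      (add_le_add_right (Finset.card_union_le _ _) _)) _))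
  omega

end SlabSurface

theorem PartialRoof.complexity_le {n : ℕ} [NeZero n] {P : SimplePolygon n} {M : MotorcycleGraph P}
    {start : ZMod n} {k : ℕ} (R : PartialRoof M start k) (hgp : M.GeneralPosition) (hk : k ≤ n) :
    R.complexity ≤ 16 * k := by
  have h₁ := R.card_isBoundary_le R.noSuperfluousVertex R.boundaryProperty
  have h₂ := R.isDisk.card_edge_le
  have h₃ := R.three_mul_card_vertex_le (R.three_le_degree hgp hk R.noSuperfluousVertex)
  have h₄ := R.card_dart_add_card_boundary_le
  rw [GluedSurface.complexity]
  omega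

end StraightSkeleton

theorem mainTheorem5 :
    ∃ c : ℕ, ∀ (n : ℕ) [NeZero n] (P : StraightSkeleton.SimplePolygon n)
      (M : StraightSkeleton.MotorcycleGraph P),
      M.NonDegenerate → M.GeneralPosition →
      ∀ (start : ZMod n) (k : ℕ), 1 ≤ k → k ≤ n →
      ∀ R : StraightSkeleton.PartialRoof M start k, R.complexity ≤ c * k :=
  ⟨16, fun _ _ _ _ _ hgp _ _ _ hk R => R.complexity_le hgp hk⟩
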